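/- Let $k \ge 2$ and $n \ge k^4+5k^3+2k^2+8k+12$ be integers, and let $G$ be a simple graph of order $n$ with minimum degree $\delta(G)\ge k$. Let $S_n^k = K_k \vee (K_{n-(2k-1)} + (k-1)K_1)$, where $+$ denotes disjoint union, $\vee$ denotes join, and $(k-1)K_1$ is the graph with $k-1$ vertices and no edges. For a graph $H$, let $q(H)$ be the largest eigenvalue of its signless Laplacian matrix $Q(H)=D(H)+A(H)$, where $D(H)$ is the diagonal matrix of vertex degrees and $A(H)$ is the adjacency matrix. If $$q(G)\ge q(S_n^k),$$ then $G$ is Hamilton-connected (every two distinct vertices of $G$ are the ends of a path containing all vertices of $G$) unless $G$ is isomorphic to $S_n^k$, in which case $G$ is not Hamilton-connected. -/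

import Mathlib

namespace SimpleGraph

/-- The join `G ∨ H`: the disjoint union of `G` and `H` together with all edges between them. -/
def joinGraph {V W : Type*} (G : SimpleGraph V) (H : SimpleGraph W) : SimpleGraph (V ⊕ W) :=
  (G ⊕g H) ⊔ completeBipartiteGraph V W

/-- `S_n^k = K_k ∨ (K_{n-(2k-1)} + (k-1) K_1)`; it has order `n` whenever `1 ≤ k` and
`2 * k - 1 ≤ n`, the only range in which it is used. -/
def graphS (n k : ℕ) : SimpleGraph (Fin k ⊕ (Fin (n - (2 * k - 1)) ⊕ Fin (k - 1))) :=
  joinGraph (completeGraph (Fin k))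
    (completeGraph (Fin (n - (2 * k - 1))) ⊕g (⊥ : SimpleGraph (Fin (k - 1))))

open Classical in
/-- The signless Laplacian matrix `Q(G) = D(G) + A(G)`, over the reals. -/
noncomputable def signlessLapMatrix {V : Type*} [Fintype V] (G : SimpleGraph V) : Matrix V V ℝ :=
  G.degMatrix ℝ + G.adjMatrix ℝ

open Classical in
/-- The signless Laplacian spectral radius `q(G)`: the largest eigenvalue of `Q(G)`. On a nonempty
vertex set the supremum is a maximum, see `isGreatest_signlessSpectralRadius`. -/
noncomputable def signlessSpectralRadius {V : Type*} [Fintype V] (G : SimpleGraph V) : ℝ :=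
  sSup {μ : ℝ | Module.End.HasEigenvalue (Matrix.toLin' G.signlessLapMatrix) μ}

open Classical in
theorem isGreatest_signlessSpectralRadius {V : Type*} [Fintype V] [Nonempty V]
    (G : SimpleGraph V) :
    IsGreatest {μ : ℝ | Module.End.HasEigenvalue (Matrix.toLin' G.signlessLapMatrix) μ}
      G.signlessSpectralRadius := by
  have hH : G.signlessLapMatrix.IsHermitian :=
    (G.isHermitian_degMatrix ℝ).add (G.isHermitian_adjMatrix ℝ)
  have hfin : {μ : ℝ | Module.End.HasEigenvalue (Matrix.toLin' G.signlessLapMatrix) μ}.Finite :=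
    Module.End.finite_hasEigenvalue _
  have hne : {μ : ℝ |
      Module.End.HasEigenvalue (Matrix.toLin' G.signlessLapMatrix) μ}.Nonempty := by
    obtain ⟨i⟩ := ‹Nonempty V›
    refine ⟨hH.eigenvalues i, ?_⟩
    rw [Set.mem_ofPred_eq, Module.End.hasEigenvalue_iff_mem_spectrum, Matrix.spectrum_toLin']
    exact hH.eigenvalues_mem_spectrum_real i
  exact ⟨hne.csSup_mem hfin, fun _ h => le_csSup hfin.bddAbove h⟩

/-- A graph is Hamilton-connected if any two distinct vertices are the ends of a Hamilton path. -/
def HamiltonConnected {V : Type*} [DecidableEq V] (G : SimpleGraph V) : Prop :=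
  ∀ u v : V, u ≠ v → ∃ p : G.Walk u v, p.IsHamiltonian

end SimpleGraph

/-!
Write `q` for the signless Laplacian spectral radius and `S` for `graphS n k`. Suppose that
`q(S) ≤ q(G)` and that `G` is not Hamilton-connected, and let `H ⊇ G` be a maximal graph on the same
vertices that is not Hamilton-connected. Ore's crossing argument
(`adj_of_maximal_not_hamiltonConnected`) shows that `H` is closed: vertices with degree sum above
`n` are adjacent. No closure operation has to be constructed.

Since `S` contains a clique on `n - k + 1` vertices, `2 (n - k) ≤ q(S) ≤ q(G) ≤ q(H)`. Testing
`Q(H)` on the vector of degrees turns this into a lower bound for the number of edges of `H`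
(`le_sum_degree_of_le_signlessSpectralRadius`). For `n` large, a closed graph that is not complete,
with so many edges and with minimum degree at least `k`, is very rigid
(`exists_structure_of_closed`): it is a clique on `n - k + 1` vertices and a set `O` of `k - 1`
vertices of degree exactly `k`, all of them with the same neighbours `F₀` in the clique.

If `F₀` has fewer than `k` elements, replacing the edges inside `O` by edges to further clique
vertices gives a copy of `S`, and a top eigenvector of `H` shows that this strictly increases `q`
(`exists_eq_splitGraph_or_lt`), contradicting `q(S) ≤ q(H)`. So `F₀` has `k` elements and `H` is a
copy of `S`. As `G ≤ H` and `q(H) ≤ q(G)`, strict monotonicity of `q` gives `G = H`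
(`eq_splitGraph_of_le`).

That `S` itself is not Hamilton-connected is a counting argument
(`not_hamiltonConnected_splitGraph`). Copies of `S` on the vertex set of `G` are handled as
`splitGraph F O`.
-/

namespace SimpleGraph

/-! ### The signless Laplacian form and its top eigenvector -/

section Spectral

variable {V : Type*} [Fintype V]

open Matrix

open Classical in
theorem signlessLapMatrix_mulVec (G : SimpleGraph V) (x : V → ℝ) (u : V) :
    (G.signlessLapMatrix *ᵥ x) u = ∑ v, if G.Adj u v then x u + x v else 0 := by
  rw [signlessLapMatrix, add_mulVec, Pi.add_apply, adjMatrix_mulVec_apply, degMatrix,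
    mulVec_diagonal, ← card_neighborFinset_eq_degree, ← nsmul_eq_mul, ← Finset.sum_const,
    ← Finset.sum_add_distrib, neighborFinset_eq_filter, Finset.sum_filter]

theorem isHermitian_signlessLapMatrix (G : SimpleGraph V) : G.signlessLapMatrix.IsHermitian := by
  classical
  exact (G.isHermitian_degMatrix ℝ).add (G.isHermitian_adjMatrix ℝ)

open Classical in
/-- Twice the quadratic form of the signless Laplacian, as a sum over ordered pairs of adjacent
vertices (so that every edge is counted twice). -/
noncomputable def signlessForm (G : SimpleGraph V) (x : V → ℝ) : ℝ :=
  ∑ u, ∑ v, if G.Adj u v then (x u + x v) ^ 2 else 0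

theorem signlessForm_eq (G : SimpleGraph V) (x : V → ℝ) :
    G.signlessForm x = 2 * (x ⬝ᵥ (G.signlessLapMatrix *ᵥ x)) := by
  classical
  have h1 : x ⬝ᵥ (G.signlessLapMatrix *ᵥ x)
      = ∑ u, ∑ v, if G.Adj u v then x u * (x u + x v) else 0 := by
    simp only [dotProduct, signlessLapMatrix_mulVec, Finset.mul_sum, mul_ite, mul_zero]
  have h2 : x ⬝ᵥ (G.signlessLapMatrix *ᵥ x)
      = ∑ u, ∑ v, if G.Adj u v then x v * (x u + x v) else 0 := by
    rw [h1, Finset.sum_comm]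
    refine Finset.sum_congr rfl fun u _ => Finset.sum_congr rfl fun v _ => ?_
    simp only [G.adj_comm u v, add_comm (x u)]
  rw [two_mul]
  nth_rewrite 1 [h1]
  rw [h2, ← Finset.sum_add_distrib, signlessForm]
  refine Finset.sum_congr rfl fun u _ => ?_
  rw [← Finset.sum_add_distrib]
  refine Finset.sum_congr rfl fun v _ => ?_
  split_ifs <;> ring

theorem signlessForm_mono {G H : SimpleGraph V} (h : G ≤ H) (x : V → ℝ) :
    G.signlessForm x ≤ H.signlessForm x := by
  classical
  refine Finset.sum_le_sum fun u _ => Finset.sum_le_sum fun v _ => ?_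
  by_cases hG : G.Adj u v
  · simp [hG, h hG]
  · simp only [hG, if_false]
    positivity

theorem signlessForm_of_eigenvector {G : SimpleGraph V} {x : V → ℝ} {q : ℝ}
    (h : G.signlessLapMatrix *ᵥ x = q • x) :
    G.signlessForm x = 2 * (q * ∑ v, x v ^ 2) := by
  rw [signlessForm_eq, h, dotProduct_smul]
  simp [dotProduct, sq]

theorem sum_sq_pos {x : V → ℝ} (hx : x ≠ 0) : 0 < ∑ v, x v ^ 2 := by
  obtain ⟨w, hw⟩ := Function.ne_iff.1 hx
  exact Finset.sum_pos' (fun v _ => sq_nonneg _) ⟨w, Finset.mem_univ _, sq_pos_of_ne_zero hw⟩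

variable [Nonempty V]

open Classical in
theorem posSemidef_sub_signlessLapMatrix (G : SimpleGraph V) :
    (G.signlessSpectralRadius • (1 : Matrix V V ℝ) - G.signlessLapMatrix).PosSemidef := by
  have hH : (G.signlessSpectralRadius • (1 : Matrix V V ℝ) - G.signlessLapMatrix).IsHermitian :=
    (isHermitian_one.smul (IsSelfAdjoint.all _)).sub G.isHermitian_signlessLapMatrix
  rw [hH.posSemidef_iff_eigenvalues_nonneg]
  intro i
  have hv := hH.mulVec_eigenvectorBasis i
  have hne : (hH.eigenvectorBasis i).ofLp ≠ 0 := fun h =>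
    hH.eigenvectorBasis.orthonormal.ne_zero i (by ext j; exact congrFun h j)
  rw [sub_mulVec, smul_mulVec, one_mulVec] at hv
  have hQ : G.signlessLapMatrix *ᵥ (hH.eigenvectorBasis i).ofLp
      = (G.signlessSpectralRadius - hH.eigenvalues i) • (hH.eigenvectorBasis i).ofLp := by
    rw [sub_smul, ← hv]
    simp
  have hle := mem_upperBounds.1 G.isGreatest_signlessSpectralRadius.2
    (G.signlessSpectralRadius - hH.eigenvalues i) (by
      refine Module.End.hasEigenvalue_of_hasEigenvector
        (x := (hH.eigenvectorBasis i).ofLp) ⟨?_, hne⟩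
      rw [Module.End.mem_eigenspace_iff, toLin'_apply]
      exact hQ)
  simp only [Pi.zero_apply]
  linarith

theorem signlessForm_le (G : SimpleGraph V) (x : V → ℝ) :
    G.signlessForm x ≤ 2 * (G.signlessSpectralRadius * ∑ v, x v ^ 2) := by
  classical
  have h := G.posSemidef_sub_signlessLapMatrix.dotProduct_mulVec_nonneg x
  rw [sub_mulVec, smul_mulVec, one_mulVec, dotProduct_sub, dotProduct_smul, star_trivial] at h
  rw [signlessForm_eq]
  have : x ⬝ᵥ x = ∑ v, x v ^ 2 := by simp [dotProduct, sq]
  rw [this, smul_eq_mul] at h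
  linarith

/-- Replacing a top eigenvector by its absolute value does not decrease the form, so the absolute
value is again a top eigenvector. -/
theorem exists_nonneg_eigenvector (G : SimpleGraph V) :
    ∃ x : V → ℝ, (∀ v, 0 ≤ x v) ∧ x ≠ 0 ∧
      G.signlessLapMatrix *ᵥ x = G.signlessSpectralRadius • x := by
  classical
  obtain ⟨y, hy, hy0⟩ := G.isGreatest_signlessSpectralRadius.1.exists_hasEigenvector
  rw [Module.End.mem_eigenspace_iff, toLin'_apply] at hy
  refine ⟨fun v => |y v|, fun v => abs_nonneg _, fun h => hy0 ?_, ?_⟩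
  · ext v
    exact abs_eq_zero.1 (congrFun h v)
  have hle : G.signlessForm y ≤ G.signlessForm fun v => |y v| := by
    refine Finset.sum_le_sum fun u _ => Finset.sum_le_sum fun v _ => ?_
    split_ifs
    · exact sq_le_sq' (by linarith [neg_abs_le (y u), neg_abs_le (y v)])
        (by linarith [le_abs_self (y u), le_abs_self (y v)])
    · exact le_rfl
  have hge := G.signlessForm_le fun v => |y v|
  rw [signlessForm_of_eigenvector hy] at hle
  simp only [sq_abs] at hge
  have h0 := (G.posSemidef_sub_signlessLapMatrix.dotProduct_mulVec_zero_iff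
    (fun v => |y v|)).1 (by
      rw [sub_mulVec, smul_mulVec, one_mulVec, dotProduct_sub, dotProduct_smul, star_trivial]
      have h2 := G.signlessForm_eq fun v => |y v|
      have : (fun v => |y v|) ⬝ᵥ (fun v => |y v|) = ∑ v, y v ^ 2 := by
        simp [dotProduct, sq]
      rw [this, smul_eq_mul]
      linarith)
  rw [sub_mulVec, smul_mulVec, one_mulVec, sub_eq_zero] at h0
  exact h0.symm

/-- The Collatz–Wielandt bound: for any vector `x`, some coordinate of `Q x`
is at least `q` times that of `x`. -/
theorem exists_signlessSpectralRadius_mul_le (G : SimpleGraph V) (x : V → ℝ) :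
    ∃ u, G.signlessSpectralRadius * x u ≤ (G.signlessLapMatrix *ᵥ x) u := by
  by_contra! hlt
  obtain ⟨y, hy, hy0, hQ⟩ := G.exists_nonneg_eigenvector
  obtain ⟨w, hw⟩ := Function.ne_iff.1 hy0
  have h1 : y ⬝ᵥ (G.signlessLapMatrix *ᵥ x) = G.signlessSpectralRadius * (y ⬝ᵥ x) := by
    rw [dotProduct_mulVec, ← mulVec_transpose]
    have : G.signlessLapMatrixᵀ = G.signlessLapMatrix := by
      simpa using G.isHermitian_signlessLapMatrix.eq
    rw [this, hQ, smul_dotProduct, smul_eq_mul]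
  have h2 : y ⬝ᵥ (G.signlessLapMatrix *ᵥ x) < y ⬝ᵥ (G.signlessSpectralRadius • x) :=
    Finset.sum_lt_sum (fun v _ => mul_le_mul_of_nonneg_left (hlt v).le (hy v))
      ⟨w, Finset.mem_univ _, mul_lt_mul_of_pos_left (hlt w) (lt_of_le_of_ne (hy w) (Ne.symm hw))⟩
  rw [h1, dotProduct_smul, smul_eq_mul] at h2
  exact lt_irrefl _ h2

theorem signlessSpectralRadius_mono {G H : SimpleGraph V} (h : G ≤ H) :
    G.signlessSpectralRadius ≤ H.signlessSpectralRadius := by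
  obtain ⟨x, -, hx0, hQ⟩ := G.exists_nonneg_eigenvector
  have h1 := (signlessForm_mono h x).trans (H.signlessForm_le x)
  rw [signlessForm_of_eigenvector hQ] at h1
  exact le_of_mul_le_mul_right (by linarith) (sum_sq_pos hx0)

theorem signlessSpectralRadius_le_of_iso {W : Type*} [Fintype W] [Nonempty W]
    {G : SimpleGraph V} {H : SimpleGraph W} (e : G ≃g H) :
    G.signlessSpectralRadius ≤ H.signlessSpectralRadius := by
  classical
  obtain ⟨x, -, hx0, hQ⟩ := G.exists_nonneg_eigenvector
  have h1 := H.signlessForm_le fun w => x (e.symm w)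
  have h2 : (H.signlessForm fun w => x (e.symm w)) = G.signlessForm x := by
    rw [signlessForm, signlessForm, ← Equiv.sum_comp e.toEquiv]
    refine Finset.sum_congr rfl fun u _ => ?_
    rw [← Equiv.sum_comp e.toEquiv]
    refine Finset.sum_congr rfl fun v _ => ?_
    simp [e.map_adj_iff]
  have h3 : ∑ w, x (e.symm w) ^ 2 = ∑ v, x v ^ 2 := Equiv.sum_comp e.symm.toEquiv fun v => x v ^ 2
  rw [h2, h3, signlessForm_of_eigenvector hQ] at h1
  exact le_of_mul_le_mul_right (by linarith) (sum_sq_pos hx0)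

/-- The Rayleigh quotient of the indicator of a clique `s` is at least `2 * (s.card - 1)`. -/
theorem IsClique.le_signlessSpectralRadius {G : SimpleGraph V} {s : Finset V}
    (hs : G.IsClique s) (hne : s.Nonempty) :
    2 * ((s.card : ℝ) - 1) ≤ G.signlessSpectralRadius := by
  classical
  have h := G.signlessForm_le fun v => if v ∈ s then 1 else 0
  have h1 : ∑ v, (if v ∈ s then (1 : ℝ) else 0) ^ 2 = s.card := by simp
  have h2 : (4 : ℝ) * (s.card * (s.card - 1))
      ≤ G.signlessForm fun v => if v ∈ s then 1 else 0 := by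
    have h3 : (4 : ℝ) * (s.card * (s.card - 1)) = ∑ u ∈ s, ∑ v ∈ s.erase u, (4 : ℝ) := by
      rw [Finset.sum_congr rfl (g := fun _ => ((s.card : ℝ) - 1) * 4)]
      · rw [Finset.sum_const, nsmul_eq_mul]
        ring
      · intro u hu
        rw [Finset.sum_const, nsmul_eq_mul, Finset.cast_card_erase_of_mem hu]
    rw [h3, signlessForm]
    refine (Finset.sum_le_sum fun u hu => ?_).trans
      (Finset.sum_le_univ_sum_of_nonneg (s := s) fun u => Finset.sum_nonneg fun v _ => ?_)
    · refine (Finset.sum_le_sum fun v hv => ?_).trans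
        (Finset.sum_le_univ_sum_of_nonneg (s := s.erase u) fun v => ?_)
      · obtain ⟨hvu, hv⟩ := Finset.mem_erase.1 hv
        rw [if_pos (hs hu hv hvu.symm), if_pos hu, if_pos hv]
        norm_num
      · positivity
    · positivity
  rw [h1] at h
  have hpos : (0 : ℝ) < s.card := by exact_mod_cast hne.card_pos
  refine le_of_mul_le_mul_right ?_ hpos
  linarith

end Spectral

/-! ### Hamilton paths as enumerations of the vertices -/

section Hamilton

variable {V : Type*}

theorem exists_walk_of_adj {G : SimpleGraph V} (p : ℕ → V) (m : ℕ)
    (h : ∀ t, t < m → G.Adj (p t) (p (t + 1))) :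
    ∃ w : G.Walk (p 0) (p m), w.support = (List.range (m + 1)).map p := by
  induction m with
  | zero => exact ⟨Walk.nil, by simp⟩
  | succ m ih =>
    obtain ⟨w, hw⟩ := ih fun t ht => h t (by omega)
    refine ⟨w.concat (h m (by omega)), ?_⟩
    rw [Walk.support_concat, hw, List.range_succ (n := m + 1)]
    simp

theorem HamiltonConnected.of_iso {W : Type*} [DecidableEq V] [DecidableEq W] {G : SimpleGraph V}
    {H : SimpleGraph W} (e : G ≃g H) (h : G.HamiltonConnected) : H.HamiltonConnected := by
  intro a b hab
  obtain ⟨p, hp⟩ := h (e.symm a) (e.symm b) (e.symm.injective.ne hab)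
  have hp' := hp.map e.toHom e.bijective
  generalize p.map e.toHom = w at hp'
  have ha : e.toHom (e.symm a) = a := e.apply_symm_apply a
  have hb : e.toHom (e.symm b) = b := e.apply_symm_apply b
  rw [← ha, ← hb]
  exact ⟨w, hp'⟩

variable [Fintype V]

/-- A Hamilton path from `a` to `b`, given as an enumeration `p 0 = a, …, p (|V| - 1) = b` of the
vertices; the values of `p` from `|V|` on are irrelevant. Reversing a segment of a path is a
reindexing in this encoding. -/
structure IsHamEnum (G : SimpleGraph V) (a b : V) (p : ℕ → V) : Prop where
  start : p 0 = a
  finish : p (Fintype.card V - 1) = b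
  inj : ∀ s t, s < Fintype.card V → t < Fintype.card V → p s = p t → s = t
  adj : ∀ t, t + 1 < Fintype.card V → G.Adj (p t) (p (t + 1))

theorem exists_eq_of_injOn_card {p : ℕ → V}
    (hp : ∀ s t, s < Fintype.card V → t < Fintype.card V → p s = p t → s = t) (v : V) :
    ∃ t, t < Fintype.card V ∧ p t = v := by
  have hinj : Function.Injective fun i : Fin (Fintype.card V) => p i :=
    fun i j h => Fin.ext (hp i j i.2 j.2 h)
  obtain ⟨i, hi⟩ := ((Fintype.bijective_iff_injective_and_card _).2 ⟨hinj, by simp⟩).2 v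
  exact ⟨i, i.2, hi⟩

theorem exists_isHamiltonian_iff [DecidableEq V] {G : SimpleGraph V} {a b : V} :
    (∃ w : G.Walk a b, w.IsHamiltonian) ↔ ∃ p, G.IsHamEnum a b p := by
  have hpos : 0 < Fintype.card V := Fintype.card_pos_iff.2 ⟨a⟩
  constructor
  · rintro ⟨w, hw⟩
    have hl := hw.length_eq
    refine ⟨w.getVert, w.getVert_zero, hl ▸ w.getVert_length, fun s t hs ht h => ?_,
      fun t ht => w.adj_getVert_succ (by omega)⟩
    exact hw.isPath.getVert_injOn (by simp; omega) (by simp; omega) h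
  · rintro ⟨p, rfl, hb, hinj, hadj⟩
    obtain ⟨w, hw⟩ := exists_walk_of_adj p (Fintype.card V - 1) fun t ht => hadj t (by omega)
    subst hb
    refine ⟨w, ?_⟩
    have hpath : w.IsPath := by
      rw [Walk.isPath_def, hw]
      refine List.Nodup.map_on (fun s hs t ht h => ?_) List.nodup_range
      simp only [List.mem_range] at hs ht
      exact hinj s t (by omega) (by omega) h
    refine hpath.isHamiltonian_of_mem fun v => ?_
    obtain ⟨t, ht, rfl⟩ := exists_eq_of_injOn_card hinj v
    rw [hw]
    exact List.mem_map_of_mem (List.mem_range.2 (by omega))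

theorem hamiltonConnected_top [DecidableEq V] :
    (⊤ : SimpleGraph V).HamiltonConnected := by
  intro u v huv
  rw [exists_isHamiltonian_iff]
  have hcard : 1 < Fintype.card V := Fintype.one_lt_card_iff.2 ⟨u, v, huv⟩
  obtain ⟨n, hn⟩ : ∃ n, Fintype.card V = n + 2 := ⟨Fintype.card V - 2, by omega⟩
  let e : Fin (n + 2) ≃ V := (Fintype.equivFinOfCardEq hn).symm
  let e₁ : Fin (n + 2) ≃ V := (Equiv.swap 0 (e.symm u)).trans e
  let e₂ : Fin (n + 2) ≃ V := (Equiv.swap (Fin.last _) (e₁.symm v)).trans e₁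
  have h₁ : e₁ 0 = u := by simp [e₁]
  have h₂ : e₂ (Fin.last _) = v := by simp [e₂]
  have h₃ : e₂ 0 = u := by
    have : e₁.symm v ≠ 0 := fun h => huv (by rw [← h₁, ← h, Equiv.apply_symm_apply])
    simp only [e₂, Equiv.trans_apply]
    rw [Equiv.swap_apply_of_ne_of_ne (by simp [Fin.ext_iff]) this.symm, h₁]
  have hinj : ∀ s t, s < Fintype.card V → t < Fintype.card V →
      e₂ (Fin.ofNat (n + 2) s) = e₂ (Fin.ofNat (n + 2) t) → s = t := by
    intro s t hs ht h
    have := congrArg Fin.val (e₂.injective h)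
    simpa [Fin.ofNat, Nat.mod_eq_of_lt (hn ▸ hs), Nat.mod_eq_of_lt (hn ▸ ht)] using this
  refine ⟨fun t => e₂ (Fin.ofNat (n + 2) t), ?_, ?_, hinj, fun t ht => ?_⟩
  · simpa using h₃
  · rw [hn, ← h₂]
    congr 1
    ext
    simp [Fin.ofNat]
  · rw [top_adj]
    exact fun h => by have := hinj t (t + 1) (by omega) ht h; omega

/-- If an enumeration is a path but for the steps at `i` and `j`, and `p i ~ p j`,
`p (i + 1) ~ p (j + 1)`, then reversing the segment between these two steps repairs it. -/
theorem exists_isHamEnum_of_crossing {G : SimpleGraph V} {p : ℕ → V}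
    (hinj : ∀ s t, s < Fintype.card V → t < Fintype.card V → p s = p t → s = t)
    {i j : ℕ} (hij : i < j) (hj : j + 1 < Fintype.card V)
    (hadj : ∀ t, t + 1 < Fintype.card V → t ≠ i → t ≠ j → G.Adj (p t) (p (t + 1)))
    (h1 : G.Adj (p i) (p j)) (h2 : G.Adj (p (i + 1)) (p (j + 1))) :
    ∃ p', G.IsHamEnum (p 0) (p (Fintype.card V - 1)) p' := by
  refine ⟨fun t => if i < t ∧ t ≤ j then p (i + j + 1 - t) else p t, ?_, ?_, ?_, ?_⟩
  · simp
  · rw [if_neg (by omega)]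
  · intro s t hs ht h
    split_ifs at h
    all_goals
      have := hinj _ _ (by omega) (by omega) h
      omega
  · intro t ht
    rcases lt_trichotomy t i with h | rfl | h
    · rw [if_neg (by omega), if_neg (by omega)]
      exact hadj t ht (by omega) (by omega)
    · rw [if_neg (by omega), if_pos (by omega)]
      convert h1 using 2
      omega
    · rcases lt_trichotomy t j with h' | rfl | h'
      · rw [if_pos (by omega), if_pos (by omega)]
        have := (hadj (i + j - t) (by omega) (by omega) (by omega)).symm
        convert this using 2 <;> omega
      · rw [if_pos (by omega), if_neg (by omega)]
        convert h2 using 2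
        omega
      · rw [if_neg (by omega), if_neg (by omega)]
        exact hadj t ht (by omega) (by omega)

/-- Ore's crossing argument: an enumeration with one missing step `p i`, `p (i+1)` whose ends have
degree sum above `|V|` can be turned into a Hamilton path with the same ends. -/
theorem exists_isHamEnum_of_degree_add {G : SimpleGraph V} [DecidableRel G.Adj] {p : ℕ → V}
    (hinj : ∀ s t, s < Fintype.card V → t < Fintype.card V → p s = p t → s = t)
    {i : ℕ} (hi : i + 1 < Fintype.card V)
    (hadj : ∀ t, t + 1 < Fintype.card V → t ≠ i → G.Adj (p t) (p (t + 1)))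
    (hdeg : Fintype.card V < G.degree (p i) + G.degree (p (i + 1))) :
    ∃ p', G.IsHamEnum (p 0) (p (Fintype.card V - 1)) p' := by
  classical
  by_contra hno
  set n := Fintype.card V with hn
  let A := (Finset.range (n - 1)).filter fun t => G.Adj (p i) (p t)
  let B := (Finset.range (n - 1)).filter fun t => G.Adj (p (i + 1)) (p (t + 1))
  have hA : G.degree (p i) ≤ A.card + 1 := by
    have hsub : G.neighborFinset (p i) ⊆ insert (p (n - 1)) (A.image p) := by
      intro v hv
      rw [mem_neighborFinset] at hv
      obtain ⟨t, ht, rfl⟩ := exists_eq_of_injOn_card hinj v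
      rw [Finset.mem_insert]
      by_cases h : t = n - 1
      · exact Or.inl (by rw [h])
      · exact Or.inr (Finset.mem_image_of_mem p
          (Finset.mem_filter.2 ⟨Finset.mem_range.2 (by omega), hv⟩))
    calc G.degree (p i) ≤ _ := Finset.card_le_card hsub
      _ ≤ (A.image p).card + 1 := Finset.card_insert_le _ _
      _ ≤ A.card + 1 := by gcongr; exact Finset.card_image_le
  have hB : G.degree (p (i + 1)) ≤ B.card + 1 := by
    have hsub : G.neighborFinset (p (i + 1)) ⊆ insert (p 0) (B.image fun t => p (t + 1)) := by
      intro v hv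
      rw [mem_neighborFinset] at hv
      obtain ⟨t, ht, rfl⟩ := exists_eq_of_injOn_card hinj v
      rw [Finset.mem_insert]
      rcases t with _ | t
      · exact Or.inl rfl
      · exact Or.inr (Finset.mem_image_of_mem (fun t => p (t + 1))
          (Finset.mem_filter.2 ⟨Finset.mem_range.2 (by omega), hv⟩))
    calc G.degree (p (i + 1)) ≤ _ := Finset.card_le_card hsub
      _ ≤ (B.image fun t => p (t + 1)).card + 1 := Finset.card_insert_le _ _
      _ ≤ B.card + 1 := by gcongr; exact Finset.card_image_le
  have hdisj : Disjoint A B := by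
    rw [Finset.disjoint_left]
    intro t htA htB
    obtain ⟨ht, h1⟩ := Finset.mem_filter.1 htA
    obtain ⟨-, h2⟩ := Finset.mem_filter.1 htB
    rw [Finset.mem_range] at ht
    rcases lt_trichotomy i t with h | rfl | h
    · exact hno (exists_isHamEnum_of_crossing hinj h (by omega)
        (fun s hs hsi _ => hadj s hs hsi) h1 h2)
    · exact h1.ne rfl
    · exact hno (exists_isHamEnum_of_crossing hinj h (by omega)
        (fun s hs _ hsi => hadj s hs hsi) h1.symm h2.symm)
  have hsub : A ∪ B ⊆ (Finset.range (n - 1)).erase i := by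
    intro t ht
    rw [Finset.mem_erase]
    rcases Finset.mem_union.1 ht with h | h
    · obtain ⟨ht, h1⟩ := Finset.mem_filter.1 h
      exact ⟨fun h => h1.ne (by rw [h]), ht⟩
    · obtain ⟨ht, h1⟩ := Finset.mem_filter.1 h
      exact ⟨fun h => h1.ne (by rw [h]), ht⟩
  have hcard := Finset.card_le_card hsub
  rw [Finset.card_union_of_disjoint hdisj,
    Finset.card_erase_of_mem (Finset.mem_range.2 (by omega)), Finset.card_range] at hcard
  omega

/-- The Bondy–Chvátal closure property, for a graph that no edge can be added to without making it
Hamilton-connected. -/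
theorem adj_of_maximal_not_hamiltonConnected [DecidableEq V] {H : SimpleGraph V}
    [DecidableRel H.Adj] (hH : Maximal (fun H : SimpleGraph V => ¬ H.HamiltonConnected) H)
    {u v : V} (huv : u ≠ v) (hdeg : Fintype.card V < H.degree u + H.degree v) : H.Adj u v := by
  by_contra hnadj
  obtain ⟨a, b, hab, hno⟩ : ∃ a b, a ≠ b ∧ ¬ ∃ p, H.IsHamEnum a b p := by
    have := hH.prop
    simp only [HamiltonConnected, exists_isHamiltonian_iff] at this
    push Not at this
    simpa using this
  have hlt : H < H ⊔ edge u v := by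
    refine lt_of_le_of_ne le_sup_left fun h => hnadj ?_
    rw [h, sup_adj, edge_adj]
    simp [huv]
  obtain ⟨p, rfl, rfl, hinj, hadj⟩ :=
    exists_isHamiltonian_iff.1 (not_not.1 (hH.not_prop_of_gt hlt) a b hab)
  have hedge : ∀ t, t + 1 < Fintype.card V → H.Adj (p t) (p (t + 1)) ∨
      (p t = u ∧ p (t + 1) = v) ∨ (p t = v ∧ p (t + 1) = u) := by
    intro t ht
    have := hadj t ht
    rw [sup_adj, edge_adj] at this
    tauto
  obtain ⟨i, hi, hni⟩ : ∃ i, i + 1 < Fintype.card V ∧ ¬ H.Adj (p i) (p (i + 1)) := by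
    by_contra! h
    exact hno ⟨p, rfl, rfl, hinj, h⟩
  have hi' := (hedge i hi).resolve_left hni
  refine hno (exists_isHamEnum_of_degree_add hinj hi (fun t ht hti => ?_) ?_)
  · refine (hedge t ht).resolve_right fun h => hti ?_
    have key : p t = p i ∨ p t = p (i + 1) ∧ p (t + 1) = p i := by
      rcases hi' with ⟨h1, h2⟩ | ⟨h1, h2⟩ <;> rw [h1, h2] <;> tauto
    rcases key with h | ⟨h, h'⟩
    · exact hinj _ _ (by omega) (by omega) h
    · have e1 := hinj _ _ (by omega) (by omega) h
      have e2 := hinj _ _ (by omega) (by omega) h'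
      omega
  · rcases hi' with ⟨h1, h2⟩ | ⟨h1, h2⟩ <;> rw [h1, h2] <;> omega

end Hamilton

/-! ### The extremal graph on a given vertex set -/

section Split

variable {V : Type*}

/-- The graph in which the vertices of `F` are adjacent to everything, `O` is independent, and the
vertices outside `O` form a clique: `K_F ∨ (K_{V \ (F ∪ O)} + O)` for disjoint `F` and `O`. -/
def splitGraph (F O : Finset V) : SimpleGraph V where
  Adj u v := u ≠ v ∧ (u ∈ F ∨ v ∈ F ∨ (u ∉ O ∧ v ∉ O))
  symm := ⟨fun u v h => ⟨h.1.symm, by tauto⟩⟩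
  loopless := ⟨fun _ h => h.1 rfl⟩

theorem splitGraph_adj {F O : Finset V} {u v : V} :
    (splitGraph F O).Adj u v ↔ u ≠ v ∧ (u ∈ F ∨ v ∈ F ∨ (u ∉ O ∧ v ∉ O)) := Iff.rfl

theorem graphS_adj {n k : ℕ} {a b : Fin k ⊕ (Fin (n - (2 * k - 1)) ⊕ Fin (k - 1))} :
    (graphS n k).Adj a b ↔ a ≠ b ∧ (a.isLeft ∨ b.isLeft ∨
      ((∃ i, a = .inr (.inl i)) ∧ ∃ i, b = .inr (.inl i))) := by
  rcases a with a | a | a <;> rcases b with b | b | b <;>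
    simp [graphS, joinGraph]

variable [Fintype V] [DecidableEq V]

theorem nonempty_splitGraph_iso {n k : ℕ} (hV : Fintype.card V = n) (hk : 1 ≤ k)
    {F O : Finset V} (hF : F.card = k) (hO : O.card = k - 1) (hFO : Disjoint F O) :
    Nonempty (splitGraph F O ≃g graphS n k) := by
  have hR : (F ∪ O)ᶜ.card = n - (2 * k - 1) := by
    rw [Finset.card_compl, Finset.card_union_of_disjoint hFO, hV]
    omega
  let eF : Fin k ≃ F := (Finset.equivFinOfCardEq hF).symm
  let eO : Fin (k - 1) ≃ O := (Finset.equivFinOfCardEq hO).symm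
  let eR : Fin (n - (2 * k - 1)) ≃ ((F ∪ O)ᶜ : Finset V) := (Finset.equivFinOfCardEq hR).symm
  let g : Fin k ⊕ (Fin (n - (2 * k - 1)) ⊕ Fin (k - 1)) → V :=
    Sum.elim (fun i => eF i) (Sum.elim (fun i => eR i) (fun i => eO i))
  have hgF : ∀ i, (eF i : V) ∈ F ∧ (eF i : V) ∉ O := fun i =>
    ⟨(eF i).2, Finset.disjoint_left.1 hFO (eF i).2⟩
  have hgO : ∀ i, (eO i : V) ∈ O ∧ (eO i : V) ∉ F := fun i =>
    ⟨(eO i).2, Finset.disjoint_right.1 hFO (eO i).2⟩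
  have hgR : ∀ i, (eR i : V) ∉ F ∧ (eR i : V) ∉ O := fun i => by
    have := (eR i).2
    simpa using this
  have hginj : Function.Injective g := by
    rintro (a | a | a) (b | b | b) h <;> simp only [g, Sum.elim_inl, Sum.elim_inr] at h
    · rw [eF.injective (Subtype.ext h)]
    · exact absurd (h ▸ (hgF a).1) (hgR b).1
    · exact absurd (h ▸ (hgF a).1) (hgO b).2
    · exact absurd (h ▸ (hgF b).1) (hgR a).1
    · rw [eR.injective (Subtype.ext h)]
    · exact absurd (h ▸ (hgO b).1) (hgR a).2
    · exact absurd (h ▸ (hgO a).1) (hgF b).2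
    · exact absurd (h ▸ (hgO a).1) (hgR b).2
    · rw [eO.injective (Subtype.ext h)]
  have hgsurj : Function.Surjective g := by
    intro v
    by_cases hvF : v ∈ F
    · exact ⟨.inl (eF.symm ⟨v, hvF⟩), by simp [g]⟩
    by_cases hvO : v ∈ O
    · exact ⟨.inr (.inr (eO.symm ⟨v, hvO⟩)), by simp [g]⟩
    · exact ⟨.inr (.inl (eR.symm ⟨v, by simp [hvF, hvO]⟩)), by simp [g]⟩
  refine ⟨Iso.symm ⟨Equiv.ofBijective g ⟨hginj, hgsurj⟩, ?_⟩⟩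
  intro a b
  change (splitGraph F O).Adj (g a) (g b) ↔ _
  rw [graphS_adj, splitGraph_adj, hginj.ne_iff]
  refine and_congr_right fun _ => ?_
  rcases a with a | a | a <;> rcases b with b | b | b <;>
    simp [g, hgF, hgO, hgR]

/-- A Hamilton path between two vertices of `F` would have to alternate between `F` and `O`:
each vertex of `O` has a predecessor in `F`, and there are only `k - 1` vertices of `F` besides the
last one, so every one of those precedes a vertex of `O`. -/
theorem not_hamiltonConnected_splitGraph {F O : Finset V} (hF : 2 ≤ F.card)
    (hO : O.card + 1 = F.card) (hFO : Disjoint F O) (hlt : F.card + O.card < Fintype.card V) :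
    ¬ (splitGraph F O).HamiltonConnected := by
  intro hHC
  obtain ⟨u, v, hu, hv, huv⟩ : ∃ u v, u ∈ F ∧ v ∈ F ∧ u ≠ v := by
    obtain ⟨u, hu, v, hv, h⟩ := Finset.one_lt_card.1 (show 1 < F.card by omega)
    exact ⟨u, v, hu, hv, h⟩
  obtain ⟨p, h0, hlast, hinj, hadj⟩ := exists_isHamiltonian_iff.1 (hHC u v huv)
  have hOF : ∀ a b, (splitGraph F O).Adj a b → a ∈ O → b ∈ F := by
    intro a b hab ha
    have := Finset.disjoint_right.1 hFO ha
    rw [splitGraph_adj] at hab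
    tauto
  have hpre : ∀ o ∈ O, ∃ t, t + 1 < Fintype.card V ∧ p (t + 1) = o ∧ p t ∈ F.erase v := by
    intro o ho
    obtain ⟨t, ht, rfl⟩ := exists_eq_of_injOn_card hinj o
    rcases t with _ | t
    · exact absurd (h0 ▸ hu) (Finset.disjoint_right.1 hFO ho)
    · refine ⟨t, ht, rfl, Finset.mem_erase.2
        ⟨fun h => ?_, hOF _ _ (hadj t ht).symm ho⟩⟩
      have := hinj t (Fintype.card V - 1) (by omega) (by omega) (h.trans hlast.symm)
      omega
  choose! τ hτ1 hτ2 hτ3 using hpre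
  have hsucc : ∀ t, t + 1 < Fintype.card V → p t ∈ F → p (t + 1) ∈ O := by
    intro t ht hpt
    have hmem : p t ∈ F.erase v := Finset.mem_erase.2 ⟨fun h => by
      have := hinj t (Fintype.card V - 1) (by omega) (by omega) (h.trans hlast.symm)
      omega, hpt⟩
    obtain ⟨o, ho, h⟩ := Finset.surj_on_of_inj_on_of_card_le (s := O) (t := F.erase v)
      (fun o _ => p (τ o)) (fun o ho => hτ3 o ho)
      (fun o o' ho ho' h => by
        have := hinj _ _ (by have := hτ1 o ho; omega) (by have := hτ1 o' ho'; omega) h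
        rw [← hτ2 o ho, this, hτ2 o' ho'])
      (by rw [Finset.card_erase_of_mem hv]; omega) (p t) hmem
    have h' := hinj _ _ (by omega) (by have := hτ1 o ho; omega) h
    rw [h', hτ2 o ho]
    exact ho
  have hall : ∀ t, t < Fintype.card V → p t ∈ F ∪ O := by
    intro t
    induction t with
    | zero => exact fun _ => Finset.mem_union_left _ (h0 ▸ hu)
    | succ t ih =>
      intro ht
      rcases Finset.mem_union.1 (ih (by omega)) with h | h
      · exact Finset.mem_union_right _ (hsucc t ht h)
      · exact Finset.mem_union_left _ (hOF _ _ (hadj t ht) h)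
  have huniv : Finset.univ ⊆ F ∪ O := by
    intro w _
    obtain ⟨t, ht, rfl⟩ := exists_eq_of_injOn_card hinj w
    exact hall t ht
  have := (Finset.card_le_card huniv).trans (Finset.card_union_le F O)
  rw [Finset.card_univ] at this
  omega

end Split

/-! ### From the spectral radius to the number of edges -/

section Extremal

variable {V : Type*} [Fintype V]

open Matrix

theorem signlessLapMatrix_mulVec_eq_degree (G : SimpleGraph V) [DecidableRel G.Adj]
    (x : V → ℝ) (u : V) :
    (G.signlessLapMatrix *ᵥ x) u = G.degree u * x u + ∑ v ∈ G.neighborFinset u, x v := by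
  rw [signlessLapMatrix_mulVec, ← card_neighborFinset_eq_degree, ← nsmul_eq_mul,
    ← Finset.sum_const, ← Finset.sum_add_distrib, neighborFinset_eq_filter, Finset.sum_filter]
  exact Finset.sum_congr rfl fun v _ => by congr

/-- A form of the Feng–Yu bound `q ≤ 2m / (n - 1) + n - 2`, obtained by testing the
Collatz–Wielandt bound on the vector of degrees. -/
theorem le_sum_degree_of_le_signlessSpectralRadius [Nonempty V] (G : SimpleGraph V)
    [DecidableRel G.Adj] (hδ : ∀ v, 1 ≤ G.degree v) {k : ℝ}
    (hq : 2 * ((Fintype.card V : ℝ) - k) ≤ G.signlessSpectralRadius) :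
    ((Fintype.card V : ℝ) - 1) * (Fintype.card V - 2 * k + 2) ≤ ∑ v, (G.degree v : ℝ) := by
  classical
  obtain ⟨u, hu⟩ := G.exists_signlessSpectralRadius_mul_le fun v => (G.degree v : ℝ)
  rw [signlessLapMatrix_mulVec_eq_degree] at hu
  set n : ℝ := (Fintype.card V : ℝ) with hn
  set d : ℝ := (G.degree u : ℝ) with hd
  have hle : ∀ v, (G.degree v : ℝ) ≤ n - 1 := fun v => by
    have : G.degree v + 1 ≤ Fintype.card V := G.degree_lt_card_verts v
    have : ((G.degree v + 1 : ℕ) : ℝ) ≤ n := Nat.cast_le.2 this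
    push_cast at this
    linarith
  have hd1 : 1 ≤ d := Nat.one_le_cast.2 (hδ u)
  have hcard : ((G.neighborFinset u).card : ℝ) = d := by rw [card_neighborFinset_eq_degree]
  have h1 : ∑ v ∈ G.neighborFinset u, (G.degree v : ℝ) ≤ d * (n - 1) := by
    refine (Finset.sum_le_sum fun v _ => hle v).trans ?_
    rw [Finset.sum_const, nsmul_eq_mul, hcard]
  have h2 : ∑ v ∈ G.neighborFinset u, (G.degree v : ℝ)
      ≤ ∑ v, (G.degree v : ℝ) - d - (n - 1 - d) := by
    have hu' : u ∉ G.neighborFinset u := by simp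
    have hsplit := Finset.sum_add_sum_compl (insert u (G.neighborFinset u))
      fun v => (G.degree v : ℝ)
    rw [Finset.sum_insert hu'] at hsplit
    have hc : (((insert u (G.neighborFinset u))ᶜ.card : ℕ) : ℝ) = n - 1 - d := by
      rw [Finset.card_compl, Finset.card_insert_of_notMem hu', card_neighborFinset_eq_degree,
        Nat.cast_sub (G.degree_lt_card_verts u)]
      push_cast
      ring
    have : n - 1 - d ≤ ∑ v ∈ (insert u (G.neighborFinset u))ᶜ, (G.degree v : ℝ) := by
      rw [← hc, ← nsmul_one, ← Finset.sum_const]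
      exact Finset.sum_le_sum fun v _ => by exact_mod_cast hδ v
    linarith
  have h3 : 2 * (n - k) * d ≤ d * d + ∑ v ∈ G.neighborFinset u, (G.degree v : ℝ) :=
    (mul_le_mul_of_nonneg_right hq (by linarith)).trans hu
  have h4 : n - 2 * k + 1 ≤ d := by
    have : 2 * (n - k) * d ≤ (d + (n - 1)) * d := by linarith
    have := le_of_mul_le_mul_right this (by linarith)
    linarith
  -- `t * (2n - 2k - t)` takes the same value at both ends of `[n - 2k + 1, n - 1]`.
  nlinarith [mul_nonneg (sub_nonneg.2 h4) (sub_nonneg.2 (hle u))]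

/-! ### Structure of the closed dense graphs -/

/-- A dense closed graph that is not complete consists of a clique together with a set `O` of
`k - 1` vertices of degree `k`, where each vertex of the clique sees all of `O` or nothing of it.
The clique is made of the vertices of degree above `n / 2`; the number of edges first forces
`s = |O| ≤ 4k - 4`, then closedness bounds the degrees in `O` by `s + 1`, and with this the number
of edges forces `s ≤ k - 1`, while the minimum degree gives `k ≤ s + 1`. -/
theorem exists_structure_of_closed [DecidableEq V] {H : SimpleGraph V} [DecidableRel H.Adj]
    {k : ℕ} (hk : 2 ≤ k) (hn : k ^ 4 + 5 * k ^ 3 + 2 * k ^ 2 + 8 * k + 12 ≤ Fintype.card V)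
    (hcl : ∀ u v, u ≠ v → Fintype.card V < H.degree u + H.degree v → H.Adj u v)
    (hne : H ≠ ⊤) (hδ : ∀ v, k ≤ H.degree v)
    (hsum : ((Fintype.card V : ℝ) - 1) * (Fintype.card V - 2 * k + 2) ≤ ∑ v, (H.degree v : ℝ)) :
    ∃ O : Finset V, O.card = k - 1 ∧ (∀ v ∈ O, H.degree v = k) ∧
      (∀ u v, u ∉ O → v ∉ O → u ≠ v → H.Adj u v) ∧
      ∀ w, w ∉ O → (∃ o ∈ O, H.Adj w o) → ∀ o ∈ O, H.Adj w o := by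
  set n := Fintype.card V with hn'
  let O : Finset V := Finset.univ.filter fun v => 2 * H.degree v ≤ n
  have hO : ∀ v, v ∈ O ↔ 2 * H.degree v ≤ n := fun v => by simp [O]
  have hclique : ∀ u v, u ∉ O → v ∉ O → u ≠ v → H.Adj u v := fun u v hu hv huv => by
    rw [hO] at hu hv
    exact hcl u v huv (by omega)
  set s := O.card with hs
  have hsn : s ≤ n := Finset.card_le_univ O
  have hCcard : Oᶜ.card = n - s := Finset.card_compl O
  have hCcardZ : (Oᶜ.card : ℤ) = n - s := by rw [hCcard, Nat.cast_sub hsn]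
  have hsumZ : ((n : ℤ) - 1) * (n - 2 * k + 2) ≤ ∑ v, (H.degree v : ℤ) := by exact_mod_cast hsum
  rw [← Finset.sum_add_sum_compl O] at hsumZ
  have hnZ : (k : ℤ) ^ 4 + 5 * k ^ 3 + 2 * k ^ 2 + 8 * k + 12 ≤ n := by exact_mod_cast hn
  have hkZ : (2 : ℤ) ≤ k := by exact_mod_cast hk
  have hk2 : (2 : ℤ) * k ≤ k ^ 2 := by nlinarith
  have hk3 : (2 : ℤ) * k ^ 2 ≤ k ^ 3 := by nlinarith
  have hk4 : (2 : ℤ) * k ^ 3 ≤ k ^ 4 := by nlinarith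
  have hs4 : (s : ℤ) ≤ 4 * k - 4 := by
    have h1 : ∑ v ∈ Oᶜ, (H.degree v : ℤ) ≤ (n - s) * (n - 1) := by
      rw [← hCcardZ, ← nsmul_eq_mul]
      refine Finset.sum_le_card_nsmul _ _ _ fun v _ => ?_
      have := H.degree_lt_card_verts v
      omega
    have h2 : 2 * ∑ v ∈ O, (H.degree v : ℤ) ≤ s * n := by
      rw [Finset.mul_sum, ← nsmul_eq_mul]
      refine Finset.sum_le_card_nsmul _ _ _ fun v hv => ?_
      have := (hO v).1 hv
      omega
    by_contra! hlt
    nlinarith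
  have hdegC : ∀ v, v ∉ O → n - s - 1 ≤ H.degree v := fun v hv => by
    have hsub : Oᶜ.erase v ⊆ H.neighborFinset v := fun w hw => by
      obtain ⟨hwv, hw⟩ := Finset.mem_erase.1 hw
      exact (H.mem_neighborFinset _ _).2 (hclique v w hv (Finset.mem_compl.1 hw) hwv.symm)
    have := Finset.card_le_card hsub
    rwa [Finset.card_erase_of_mem (Finset.mem_compl.2 hv), hCcard,
      card_neighborFinset_eq_degree] at this
  have hdegO : ∀ v ∈ O, H.degree v ≤ s + 1 := fun v hv => by
    by_contra! hlt
    have hsub : Oᶜ ⊆ H.neighborFinset v := fun w hw => by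
      have hw' := Finset.mem_compl.1 hw
      have := hdegC w hw'
      exact (H.mem_neighborFinset _ _).2 (hcl v w (fun h => hw' (h ▸ hv)) (by omega))
    have h1 := Finset.card_le_card hsub
    rw [card_neighborFinset_eq_degree, hCcard] at h1
    have h2 := (hO v).1 hv
    have h3 : (n : ℤ) ≤ 2 * s := by omega
    nlinarith
  have hsk : s < k := by
    have h1 : ∑ v ∈ O, (H.degree v : ℤ) ≤ s * (s + 1) := by
      rw [← nsmul_eq_mul]
      exact Finset.sum_le_card_nsmul _ _ _ fun v hv => by exact_mod_cast hdegO v hv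
    have hsplit : ∀ v ∈ Oᶜ, (H.degree v : ℤ) ≤ (n - s - 1) + ((O.filter (H.Adj v)).card : ℤ) := by
      intro v hv
      have hsub : H.neighborFinset v ⊆ Oᶜ.erase v ∪ O.filter (H.Adj v) := fun w hw => by
        rw [mem_neighborFinset] at hw
        by_cases hwO : w ∈ O
        · exact Finset.mem_union_right _ (Finset.mem_filter.2 ⟨hwO, hw⟩)
        · exact Finset.mem_union_left _
            (Finset.mem_erase.2 ⟨hw.ne', Finset.mem_compl.2 hwO⟩)
      have h := (Finset.card_le_card hsub).trans (Finset.card_union_le _ _)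
      have hpos : 0 < Oᶜ.card := Finset.card_pos.2 ⟨v, hv⟩
      rw [Finset.card_erase_of_mem hv, hCcard, card_neighborFinset_eq_degree] at h
      omega
    have hdouble : ∑ v ∈ Oᶜ, ((O.filter (H.Adj v)).card : ℤ) ≤ ∑ v ∈ O, (H.degree v : ℤ) := by
      have := Finset.sum_card_bipartiteAbove_eq_sum_card_bipartiteBelow (s := Oᶜ) (t := O) H.Adj
      simp only [Finset.bipartiteAbove, Finset.bipartiteBelow] at this
      rw [← Nat.cast_sum, this, Nat.cast_sum]
      refine Finset.sum_le_sum fun v _ => ?_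
      rw [← card_neighborFinset_eq_degree, Nat.cast_le]
      refine Finset.card_le_card fun w hw => ?_
      exact (H.mem_neighborFinset _ _).2 (Finset.mem_filter.1 hw).2.symm
    have h2 : ∑ v ∈ Oᶜ, (H.degree v : ℤ) ≤ (n - s) * (n - s - 1) + s * (s + 1) := by
      refine (Finset.sum_le_sum hsplit).trans ?_
      rw [Finset.sum_add_distrib, Finset.sum_const, nsmul_eq_mul, hCcardZ]
      linarith
    by_contra! hlt
    have hltZ : (k : ℤ) ≤ s := by exact_mod_cast hlt
    have h3 : (2 * (s : ℤ) - 2 * k + 2) * n ≤ 3 * s ^ 2 + 3 * s - 2 * k + 2 := by nlinarith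
    have h4 : (s : ℤ) ^ 2 ≤ (4 * k - 4) ^ 2 := pow_le_pow_left₀ (by omega) hs4 2
    nlinarith
  have hOne : O.Nonempty := by
    by_contra hemp
    rw [Finset.not_nonempty_iff_eq_empty] at hemp
    refine hne (top_unique fun u v huv => hclique u v ?_ ?_ huv) <;> simp [hemp]
  obtain ⟨o, ho⟩ := hOne
  have hks : s = k - 1 := by
    have h1 := hdegO o ho
    have h2 := hδ o
    omega
  have hdegk : ∀ v ∈ O, H.degree v = k := fun v hv => by
    have h1 := hdegO v hv
    have h2 := hδ v
    omega
  refine ⟨O, hks, hdegk, hclique, ?_⟩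
  rintro w hw ⟨o, ho, hwo⟩ o' ho'
  have hsub : insert o (Oᶜ.erase w) ⊆ H.neighborFinset w := fun z hz => by
    rw [mem_neighborFinset]
    rcases Finset.mem_insert.1 hz with rfl | hz
    · exact hwo
    · obtain ⟨hzw, hz⟩ := Finset.mem_erase.1 hz
      exact hclique w z hw (Finset.mem_compl.1 hz) hzw.symm
  have h1 := Finset.card_le_card hsub
  rw [Finset.card_insert_of_notMem (by simp [ho]), Finset.card_erase_of_mem
    (Finset.mem_compl.2 hw), hCcard, card_neighborFinset_eq_degree] at h1
  have h2 := hdegk o' ho'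
  refine hcl w o' (fun h => hw (h ▸ ho')) ?_
  have h3 : (2 : ℤ) * k ≤ n := by nlinarith
  omega

/-! ### Comparison with the extremal graph -/

theorem signlessForm_eq_add [DecidableEq V] (G : SimpleGraph V) [DecidableRel G.Adj] (x : V → ℝ)
    (O : Finset V) : G.signlessForm x
      = (∑ u ∈ Oᶜ, ∑ v ∈ Oᶜ, if G.Adj u v then (x u + x v) ^ 2 else 0)
      + 2 * (∑ u ∈ O, ∑ v ∈ Oᶜ, if G.Adj u v then (x u + x v) ^ 2 else 0)
      + ∑ u ∈ O, ∑ v ∈ O, if G.Adj u v then (x u + x v) ^ 2 else 0 := by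
  have hsymm : (∑ u ∈ Oᶜ, ∑ v ∈ O, if G.Adj u v then (x u + x v) ^ 2 else 0)
      = ∑ u ∈ O, ∑ v ∈ Oᶜ, if G.Adj u v then (x u + x v) ^ 2 else 0 := by
    rw [Finset.sum_comm]
    refine Finset.sum_congr rfl fun u _ => Finset.sum_congr rfl fun v _ => ?_
    simp only [G.adj_comm u v, add_comm (x u)]
  have hform : G.signlessForm x = ∑ u, ∑ v, if G.Adj u v then (x u + x v) ^ 2 else 0 :=
    Finset.sum_congr rfl fun u _ => Finset.sum_congr rfl fun v _ => by congr
  rw [hform, ← Finset.sum_add_sum_compl O]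
  simp only [← Finset.sum_add_sum_compl O (fun v => if G.Adj _ v then (x _ + x v) ^ 2 else 0),
    Finset.sum_add_distrib]
  rw [hsymm]
  ring

/-- A subgraph of `splitGraph F O` with the same spectral radius is all of it: its nonnegative top
eigenvector vanishes at the ends of any missing edge, hence on `F`, hence everywhere. -/
theorem eq_splitGraph_of_le [Nonempty V] {G : SimpleGraph V} {F O : Finset V}
    (hF : F.Nonempty) (hle : G ≤ splitGraph F O)
    (hq : (splitGraph F O).signlessSpectralRadius ≤ G.signlessSpectralRadius) :
    G = splitGraph F O := by
  classical
  by_contra hne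
  obtain ⟨a, b, hab, hnab⟩ : ∃ a b, (splitGraph F O).Adj a b ∧ ¬ G.Adj a b := by
    by_contra! h
    exact hne (le_antisymm hle fun a b => h a b)
  obtain ⟨x, hx, hx0, hQ⟩ := G.exists_nonneg_eigenvector
  set S := splitGraph F O
  have hqq := le_antisymm (signlessSpectralRadius_mono hle) hq
  have hform : S.signlessForm x = G.signlessForm x := by
    refine le_antisymm ?_ (signlessForm_mono hle x)
    rw [signlessForm_of_eigenvector hQ, hqq]
    exact S.signlessForm_le x
  have hterm : ∀ u v, (if G.Adj u v then (x u + x v) ^ 2 else 0)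
      ≤ if S.Adj u v then (x u + x v) ^ 2 else 0 := by
    intro u v
    by_cases hG : G.Adj u v
    · simp [hG, hle hG]
    · simp only [hG, if_false]
      positivity
  have hrow := (Finset.sum_eq_sum_iff_of_le fun u _ =>
    Finset.sum_le_sum fun v _ => hterm u v).1 hform.symm
  have heq : ∀ u v, (if G.Adj u v then (x u + x v) ^ 2 else 0)
      = if S.Adj u v then (x u + x v) ^ 2 else 0 := fun u v =>
    (Finset.sum_eq_sum_iff_of_le fun v _ => hterm u v).1 (hrow u (Finset.mem_univ u)) v
      (Finset.mem_univ v)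
  have hS : S.signlessLapMatrix *ᵥ x = G.signlessSpectralRadius • x := by
    rw [← hQ]
    ext u
    rw [signlessLapMatrix_mulVec, signlessLapMatrix_mulVec]
    refine Finset.sum_congr rfl fun v _ => ?_
    have h := heq u v
    by_cases hG : G.Adj u v
    · simp [hG, hle hG]
    · by_cases hS : S.Adj u v
      · simp only [hG, hS, if_true, if_false] at h ⊢
        exact pow_eq_zero_iff two_ne_zero |>.1 h.symm
      · simp [hG, hS]
  have hspread : ∀ u v, S.Adj u v → x u = 0 → x v = 0 := by
    intro u v huv hu
    have h := congrFun hS u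
    rw [signlessLapMatrix_mulVec, Pi.smul_apply, hu, smul_zero,
      Finset.sum_eq_zero_iff_of_nonneg fun w _ => by
        have := hx w
        split_ifs <;> simp [this]] at h
    simpa [huv] using h v (Finset.mem_univ v)
  have ha : x a = 0 := by
    have h := heq a b
    simp only [hab, hnab, if_true, if_false] at h
    have := pow_eq_zero_iff two_ne_zero |>.1 h.symm
    linarith [hx a, hx b]
  obtain ⟨w, hw⟩ := hF
  have hw0 : x w = 0 := by
    by_cases h : a = w
    · rwa [← h]
    · exact hspread a w ⟨h, Or.inr (Or.inl hw)⟩ ha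
  refine hx0 (funext fun v => ?_)
  by_cases h : w = v
  · rw [← h]
    exact hw0
  · exact hspread w v ⟨h, Or.inl hw⟩ hw0

/-- The edge-switching step. In a graph with the structure of `exists_structure_of_closed`, let
`F₀` be the set of clique vertices that see `O`, and enlarge it inside the clique to a set `F` with
`k` elements. Passing to `splitGraph F O` trades the edges inside `O` for edges between `F \ F₀` and
`O`. A nonnegative top eigenvector is at least as large on clique vertices outside `F₀` as on `O`,
so the trade strictly increases the form, unless `F₀ = F` already. -/
theorem exists_eq_splitGraph_or_lt [Nonempty V] [DecidableEq V] {H : SimpleGraph V}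
    [DecidableRel H.Adj] {k : ℕ} (hk : 2 ≤ k) (hn : 2 * k ≤ Fintype.card V)
    {O : Finset V} (hO : O.card = k - 1) (hdeg : ∀ v ∈ O, H.degree v = k)
    (hclique : ∀ u v, u ∉ O → v ∉ O → u ≠ v → H.Adj u v)
    (hall : ∀ w, w ∉ O → (∃ o ∈ O, H.Adj w o) → ∀ o ∈ O, H.Adj w o)
    (hq : 2 * ((Fintype.card V : ℝ) - k) ≤ H.signlessSpectralRadius) :
    ∃ F : Finset V, F.card = k ∧ Disjoint F O ∧ (H = splitGraph F O ∨
      H.signlessSpectralRadius < (splitGraph F O).signlessSpectralRadius) := by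
  obtain ⟨o, ho⟩ : O.Nonempty := Finset.card_pos.1 (by omega)
  let F₀ : Finset V := Oᶜ.filter fun w => H.Adj w o
  have hF₀O : F₀ ⊆ Oᶜ := Finset.filter_subset _ _
  have hadjF₀ : ∀ w ∈ F₀, ∀ o' ∈ O, H.Adj w o' := fun w hw =>
    hall w (Finset.mem_compl.1 (hF₀O hw)) ⟨o, ho, (Finset.mem_filter.1 hw).2⟩
  have hnadj : ∀ w, w ∉ O → w ∉ F₀ → ∀ o' ∈ O, ¬ H.Adj w o' := fun w hw hwF o' ho' h =>
    hwF (Finset.mem_filter.2 ⟨Finset.mem_compl.2 hw, hall w hw ⟨o', ho', h⟩ o ho⟩)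
  let I : V → Finset V := fun v => O.filter (H.Adj v)
  have hnbrO : ∀ v ∈ O, H.neighborFinset v = F₀ ∪ I v := fun v hv => by
    ext w
    simp only [mem_neighborFinset, Finset.mem_union, I, Finset.mem_filter]
    refine ⟨fun h => ?_, fun h => h.elim (fun h => (hadjF₀ w h v hv).symm) fun h => h.2⟩
    by_cases hw : w ∈ O
    · exact Or.inr ⟨hw, h⟩
    · exact Or.inl (by_contra fun hwF => hnadj w hw hwF v hv h.symm)
  have hdisj : ∀ v, Disjoint F₀ (I v) := fun v =>
    Finset.disjoint_left.2 fun w hw hw' =>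
      Finset.mem_compl.1 (hF₀O hw) (Finset.mem_filter.1 hw').1
  have hIcard : ∀ v ∈ O, F₀.card + (I v).card = k := fun v hv => by
    rw [← Finset.card_union_of_disjoint (hdisj v), ← hnbrO v hv, card_neighborFinset_eq_degree,
      hdeg v hv]
  have hOc : Oᶜ.card = Fintype.card V - (k - 1) := by rw [Finset.card_compl, hO]
  obtain ⟨F, hF₀F, hFO, hFk⟩ := Finset.exists_subsuperset_card_eq hF₀O
    (show F₀.card ≤ k by have := hIcard o ho; omega) (by omega)
  have hFdisj : Disjoint F O := Finset.disjoint_left.2 fun w hw => Finset.mem_compl.1 (hFO hw)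
  refine ⟨F, hFk, hFdisj, ?_⟩
  rcases (Finset.card_le_card hF₀F).eq_or_lt with heq | hlt
  · have hFF : F₀ = F := Finset.eq_of_subset_of_card_le hF₀F heq.ge
    refine Or.inl ?_
    have hO0 : ∀ u ∈ O, ∀ v ∈ O, ¬ H.Adj u v := fun u hu v hv h => by
      have hmem : v ∈ I u := Finset.mem_filter.2 ⟨hv, h⟩
      have := Finset.card_pos.2 ⟨v, hmem⟩
      have := hIcard u hu
      omega
    ext u v
    rw [splitGraph_adj, ← hFF]
    by_cases huv : u = v
    · simp [huv]
    have hFn : ∀ w ∈ F₀, w ∉ O := fun w hw => Finset.mem_compl.1 (hF₀O hw)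
    by_cases hu : u ∈ O <;> by_cases hv : v ∈ O
    · have := hO0 u hu v hv
      have h1 : u ∉ F₀ := fun h => hFn u h hu
      have h2 : v ∉ F₀ := fun h => hFn v h hv
      tauto
    · have h1 : u ∉ F₀ := fun h => hFn u h hu
      by_cases h2 : v ∈ F₀
      · have := (hadjF₀ v h2 u hu).symm
        tauto
      · have := fun h : H.Adj u v => hnadj v hv h2 u hu h.symm
        tauto
    · have h1 : v ∉ F₀ := fun h => hFn v h hv
      by_cases h2 : u ∈ F₀
      · have := hadjF₀ u h2 v hv
        tauto
      · have := hnadj u hu h2 v hv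
        tauto
    · have := hclique u v hu hv huv
      tauto
  refine Or.inr ?_
  obtain ⟨x, hx, hx0, hQ⟩ := H.exists_nonneg_eigenvector
  set q := H.signlessSpectralRadius with hqdef
  set n : ℝ := (Fintype.card V : ℝ) with hndef
  set f : ℝ := (F₀.card : ℝ) with hf
  have hkR : (2 : ℝ) ≤ k := by exact_mod_cast hk
  have hnR : 2 * (k : ℝ) ≤ n := by rw [hndef]; exact_mod_cast hn
  have hfk : f + 1 ≤ k := by
    rw [hf]
    exact_mod_cast (show F₀.card + 1 ≤ k by omega)
  -- A vertex of `O` has at most `k - 2` neighbours in `O`.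
  have hf2 : 2 ≤ f := by
    have hsub : I o ⊆ O.erase o := fun w hw => by
      obtain ⟨hw, h⟩ := Finset.mem_filter.1 hw
      exact Finset.mem_erase.2 ⟨h.ne', hw⟩
    have h1 := Finset.card_le_card hsub
    rw [Finset.card_erase_of_mem ho] at h1
    have h2 := hIcard o ho
    rw [hf]
    exact_mod_cast (show 2 ≤ F₀.card by omega)
  have hOcR : (Oᶜ.card : ℝ) = n - k + 1 := by
    rw [hOc, Nat.cast_sub (by omega), Nat.cast_sub (by omega)]
    push_cast
    ring
  set X := ∑ v ∈ F₀, x v with hX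
  obtain ⟨z, hz, hzmax⟩ := Finset.exists_max_image O x ⟨o, ho⟩
  obtain ⟨w, hw, hwmin⟩ := Finset.exists_min_image (Oᶜ \ F₀) x (by
    rw [← Finset.card_pos, Finset.card_sdiff_of_subset hF₀O]
    omega)
  have hwO : w ∉ O := Finset.mem_compl.1 (Finset.mem_sdiff.1 hw).1
  have hzle : (q - 2 * k + f) * x z ≤ X := by
    have h := congrFun hQ z
    rw [signlessLapMatrix_mulVec_eq_degree, Pi.smul_apply, smul_eq_mul, hnbrO z hz,
      Finset.sum_union (hdisj z), hdeg z hz] at h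
    have hI : ∑ v ∈ I z, x v ≤ (k - f) * x z := by
      have : ((I z).card : ℝ) = k - f := by
        rw [hf, ← hIcard z hz]
        push_cast
        ring
      rw [← this, ← nsmul_eq_mul]
      exact Finset.sum_le_card_nsmul _ _ _ fun v hv => hzmax v (Finset.mem_filter.1 hv).1
    nlinarith
  have hwsum : (q - n + k + 1) * x w = ∑ v ∈ Oᶜ, x v := by
    have hnbr : H.neighborFinset w = Oᶜ.erase w := by
      ext v
      rw [mem_neighborFinset, Finset.mem_erase]
      refine ⟨fun h => ⟨h.ne', Finset.mem_compl.2 fun hv =>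
        hnadj w hwO (Finset.mem_sdiff.1 hw).2 v hv h⟩, fun h =>
        hclique w v hwO (Finset.mem_compl.1 h.2) h.1.symm⟩
    have h := congrFun hQ w
    have hc : (H.degree w : ℝ) = n - k := by
      rw [← card_neighborFinset_eq_degree, hnbr,
        Finset.cast_card_erase_of_mem (Finset.mem_compl.2 hwO), hOcR]
      ring
    rw [signlessLapMatrix_mulVec_eq_degree, Pi.smul_apply, smul_eq_mul, hc, hnbr] at h
    have h' := Finset.add_sum_erase Oᶜ x (Finset.mem_compl.2 hwO)
    linarith
  have hwge : X ≤ (q - 2 * n + 2 * k + f) * x w := by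
    have h1 : (n - k + 1 - f) * x w ≤ ∑ v ∈ Oᶜ \ F₀, x v := by
      have : ((Oᶜ \ F₀).card : ℝ) = n - k + 1 - f := by
        rw [Finset.cast_card_sdiff hF₀O, hOcR]
      rw [← this, ← nsmul_eq_mul]
      exact Finset.card_nsmul_le_sum _ _ _ hwmin
    have h2 := Finset.sum_sdiff (f := x) hF₀O
    nlinarith
  have hzw : x z ≤ x w := by
    have h1 : (q - 2 * n + 2 * k + f) * x z ≤ (q - 2 * k + f) * x z :=
      mul_le_mul_of_nonneg_right (by linarith) (hx z)
    exact le_of_mul_le_mul_left (h1.trans (hzle.trans hwge)) (by linarith)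
  have hwpos : 0 < x w := by
    refine lt_of_le_of_ne (hx w) fun h0 => hx0 (funext fun v => ?_)
    rw [← h0, mul_zero] at hwsum
    by_cases hv : v ∈ O
    · exact le_antisymm ((hzmax v hv).trans (hzw.trans h0.ge)) (hx v)
    · exact (Finset.sum_eq_zero_iff_of_nonneg fun v _ => hx v).1 hwsum.symm v
        (Finset.mem_compl.2 hv)
  have hform : H.signlessForm x < (splitGraph F O).signlessForm x := by
    classical
    have h1 : (∑ u ∈ Oᶜ, ∑ v ∈ Oᶜ, if H.Adj u v then (x u + x v) ^ 2 else 0)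
        ≤ ∑ u ∈ Oᶜ, ∑ v ∈ Oᶜ, if (splitGraph F O).Adj u v then (x u + x v) ^ 2 else 0 := by
      refine Finset.sum_le_sum fun u hu => Finset.sum_le_sum fun v hv => le_of_eq ?_
      rw [Finset.mem_compl] at hu hv
      have : H.Adj u v ↔ (splitGraph F O).Adj u v := by
        rw [splitGraph_adj]
        exact ⟨fun h => ⟨h.ne, by tauto⟩, fun h => hclique u v hu hv h.1⟩
      simp only [this]
    have h2 : ∀ u ∈ O, (∑ v ∈ Oᶜ, if H.Adj u v then (x u + x v) ^ 2 else 0)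
        + (k - f) * (x w ^ 2 + 3 * x u ^ 2)
        ≤ ∑ v ∈ Oᶜ, if (splitGraph F O).Adj u v then (x u + x v) ^ 2 else 0 := by
      intro u hu
      have e1 : (∑ v ∈ Oᶜ, if H.Adj u v then (x u + x v) ^ 2 else 0)
          = ∑ v ∈ F₀, (x u + x v) ^ 2 := by
        rw [← Finset.sum_filter]
        refine Finset.sum_congr (Finset.ext fun v => ?_) fun _ _ => rfl
        rw [Finset.mem_filter]
        refine ⟨fun h => by_contra fun hv =>
          hnadj v (Finset.mem_compl.1 h.1) hv u hu h.2.symm,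
          fun h => ⟨hF₀O h, (hadjF₀ v h u hu).symm⟩⟩
      have e2 : (∑ v ∈ Oᶜ, if (splitGraph F O).Adj u v then (x u + x v) ^ 2 else 0)
          = ∑ v ∈ F, (x u + x v) ^ 2 := by
        rw [← Finset.sum_filter]
        refine Finset.sum_congr (Finset.ext fun v => ?_) fun _ _ => rfl
        rw [Finset.mem_filter, splitGraph_adj]
        have huF : u ∉ F := Finset.disjoint_right.1 hFdisj hu
        refine ⟨fun h => by tauto, fun h => ⟨hFO h, fun huv => huF (huv ▸ h), Or.inr (Or.inl h)⟩⟩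
      have e3 : (k - f) * (x w ^ 2 + 3 * x u ^ 2) ≤ ∑ v ∈ F \ F₀, (x u + x v) ^ 2 := by
        have : ((F \ F₀).card : ℝ) = k - f := by
          rw [Finset.cast_card_sdiff hF₀F, hFk]
        rw [← this, ← nsmul_eq_mul]
        refine Finset.card_nsmul_le_sum _ _ _ fun v hv => ?_
        have hwv : x w ≤ x v := hwmin v (Finset.sdiff_subset_sdiff hFO subset_rfl hv)
        have huw : x u ≤ x w := (hzmax u hu).trans hzw
        nlinarith [hx u, hx w]
      rw [e1, e2, ← Finset.sum_sdiff hF₀F]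
      linarith
    have h3 : (∑ u ∈ O, ∑ v ∈ O, if H.Adj u v then (x u + x v) ^ 2 else 0)
        ≤ ∑ u ∈ O, 4 * (k - f) * x u ^ 2 := by
      have hrow : ∀ u ∈ O, (∑ v ∈ O, if H.Adj u v then x u ^ 2 else 0) = (k - f) * x u ^ 2 := by
        intro u hu
        have : ((I u).card : ℝ) = k - f := by
          rw [hf, ← hIcard u hu]
          push_cast
          ring
        rw [← Finset.sum_filter, Finset.sum_const, nsmul_eq_mul, ← this]
      have hcol : (∑ u ∈ O, ∑ v ∈ O, if H.Adj u v then x v ^ 2 else 0)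
          = ∑ u ∈ O, (k - f) * x u ^ 2 := by
        rw [Finset.sum_comm, ← Finset.sum_congr rfl hrow]
        simp only [H.adj_comm]
      calc (∑ u ∈ O, ∑ v ∈ O, if H.Adj u v then (x u + x v) ^ 2 else 0)
          ≤ ∑ u ∈ O, ∑ v ∈ O, (2 * (if H.Adj u v then x u ^ 2 else 0)
              + 2 * if H.Adj u v then x v ^ 2 else 0) := by
            refine Finset.sum_le_sum fun u _ => Finset.sum_le_sum fun v _ => ?_
            split_ifs
            · nlinarith [sq_nonneg (x u - x v)]
            · simp
        _ = ∑ u ∈ O, 4 * (k - f) * x u ^ 2 := by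
            simp only [Finset.sum_add_distrib, ← Finset.mul_sum]
            rw [hcol, Finset.sum_congr rfl hrow, ← Finset.mul_sum]
            ring
    have h4 : 0 ≤ ∑ u ∈ O, ∑ v ∈ O,
        if (splitGraph F O).Adj u v then (x u + x v) ^ 2 else 0 :=
      Finset.sum_nonneg fun u _ => Finset.sum_nonneg fun v _ => by positivity
    have h5 := Finset.sum_le_sum h2
    rw [Finset.sum_add_distrib] at h5
    have h6 : ∑ u ∈ O, 4 * (k - f) * x u ^ 2
        < 2 * ∑ u ∈ O, (k - f) * (x w ^ 2 + 3 * x u ^ 2) := by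
      rw [Finset.mul_sum]
      refine Finset.sum_lt_sum_of_nonempty ⟨o, ho⟩ fun u _ => ?_
      have : 0 < (k - f) * (x w ^ 2 + x u ^ 2) := by
        have : 0 < (k : ℝ) - f := by linarith
        positivity
      linarith
    rw [signlessForm_eq_add H x O, signlessForm_eq_add (splitGraph F O) x O]
    linarith
  have h := hform.trans_le ((splitGraph F O).signlessForm_le x)
  rw [signlessForm_of_eigenvector hQ] at h
  exact lt_of_mul_lt_mul_right (by linarith) (sum_sq_pos hx0).le

end Extremal

end SimpleGraph

open SimpleGraph in
theorem corollary3p5 {V : Type*} [Fintype V] [DecidableEq V] (G : SimpleGraph V)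
    [DecidableRel G.Adj] (n k : ℕ) (hk : 2 ≤ k)
    (hn : k ^ 4 + 5 * k ^ 3 + 2 * k ^ 2 + 8 * k + 12 ≤ n)
    (hV : Fintype.card V = n)
    (hδ : k ≤ G.minDegree)
    (hq : (SimpleGraph.graphS n k).signlessSpectralRadius ≤ G.signlessSpectralRadius) :
    G.HamiltonConnected ↔ ¬ Nonempty (G ≃g SimpleGraph.graphS n k) := by
  have hk2n : 8 * k + 12 ≤ n := le_trans (Nat.add_le_add_right (Nat.le_add_left _ _) _) hn
  have : Nonempty V := Fintype.card_pos_iff.1 (by omega)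
  have : Nonempty (Fin k ⊕ (Fin (n - (2 * k - 1)) ⊕ Fin (k - 1))) := ⟨.inl ⟨0, by omega⟩⟩
  have hsplit : ∀ F O : Finset V, F.card = k → O.card = k - 1 → Disjoint F O →
      (splitGraph F O).signlessSpectralRadius ≤ G.signlessSpectralRadius := by
    intro F O hF hO hFO
    obtain ⟨e⟩ := nonempty_splitGraph_iso hV (by omega) hF hO hFO
    exact (signlessSpectralRadius_le_of_iso e).trans hq
  obtain ⟨O₁, -, hO₁⟩ := Finset.exists_subset_card_eq (s := (Finset.univ : Finset V))
    (n := k - 1) (by rw [Finset.card_univ]; omega)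
  have hO₁c : O₁ᶜ.card = n - (k - 1) := by rw [Finset.card_compl, hV, hO₁]
  obtain ⟨F₁, hF₁O₁, hF₁⟩ := Finset.exists_subset_card_eq (s := O₁ᶜ) (n := k) (by omega)
  have hFO₁ : Disjoint F₁ O₁ :=
    Finset.disjoint_left.2 fun w hw => Finset.mem_compl.1 (hF₁O₁ hw)
  constructor
  · rintro hHC ⟨e⟩
    obtain ⟨e'⟩ := nonempty_splitGraph_iso hV (by omega) hF₁ hO₁ hFO₁
    exact not_hamiltonConnected_splitGraph (by omega) (by omega) hFO₁ (by omega)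
      (hHC.of_iso (e.trans e'.symm))
  · intro hiso
    by_contra hHC
    have hqG : 2 * ((Fintype.card V : ℝ) - k) ≤ G.signlessSpectralRadius := by
      have hcl : (splitGraph F₁ O₁).IsClique (O₁ᶜ : Finset V) := fun u hu v hv huv =>
        ⟨huv, Or.inr (Or.inr ⟨by simpa using hu, by simpa using hv⟩)⟩
      have h := hcl.le_signlessSpectralRadius (Finset.card_pos.1 (by omega))
      rw [hO₁c, ← hV, Nat.cast_sub (by omega), Nat.cast_sub (by omega)] at h
      have := h.trans (hsplit F₁ O₁ hF₁ hO₁ hFO₁)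
      push_cast at this
      linarith
    -- A maximal non-Hamilton-connected supergraph takes the place of the closure of `G`.
    obtain ⟨H, hGH, hH⟩ := (Set.toFinite
      {H : SimpleGraph V | ¬ H.HamiltonConnected}).exists_le_maximal hHC
    classical
    have hqGH := signlessSpectralRadius_mono hGH
    have hδH : ∀ v, k ≤ H.degree v := fun v =>
      (hδ.trans (G.minDegree_le_degree v)).trans (degree_le_of_le hGH)
    obtain ⟨O, hO, hdeg, hclique, hall⟩ := exists_structure_of_closed hk (hV.symm ▸ hn)
      (fun u v => adj_of_maximal_not_hamiltonConnected hH)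
      (fun h => hH.prop (h ▸ hamiltonConnected_top)) hδH
      (le_sum_degree_of_le_signlessSpectralRadius H (fun v => by have := hδH v; omega)
        (hqG.trans hqGH))
    obtain ⟨F, hF, hFO, rfl | hlt⟩ := exists_eq_splitGraph_or_lt hk (by omega) hO hdeg hclique
      hall (hqG.trans hqGH)
    · have hG := eq_splitGraph_of_le (Finset.card_pos.1 (by omega)) hGH (hsplit F O hF hO hFO)
      rw [hG] at hiso
      exact hiso (nonempty_splitGraph_iso hV (by omega) hF hO hFO)
    · exact absurd (hlt.trans_le (hsplit F O hF hO hFO)) hqGH.not_gt
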